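/- Let $\mathbb N=\{1,2,\dots\}$. An infinite family of concepts is a pair $F=(U,C)$, where $U$ is an infinite set and $C$ is an infinite set of subsets of $U$ (concepts). For $u\in U$ and $c\in C$ put $u(c)=1$ if $u\in c$ and $u(c)=0$ otherwise. A problem over $F$ of dimension $n\in\mathbb N$ is a tuple $z=(u_1,\dots,u_n)\in U^n$; for a hidden concept $c\in C$ one has to find $z(c)=(u_1(c),\dots,u_n(c))$. A system of equations over $F$ is a finite set of equations $u(x)=\delta$ with $u\in U$, $\delta\in\{0,1\}$; it is consistent if it has a solution in $C$, and inconsistent otherwise. A decision tree over $z$ is a finite rooted tree whose terminal nodes are labeled with tuples from $\{0,1\}^n$ and whose other nodes are labeled with queries. A membership query $u_i$ has the two answers $\{u_i(x)=0\}$ and $\{u_i(x)=1\}$. An equivalence query with hypothesis $H=\{u_1(x)=\delta_1,\dots,u_n(x)=\delta_n\}$ has the $n+1$ answers $H$, $\{u_1(x)=\neg\delta_1\},\dots,\{u_n(x)=\neg\delta_n\}$; it is proper if $H$ is consistent. Each answer labels one edge to a child. The tree solves $z$ relative to $F$ if, for each $c\in C$ and each path from the root to a terminal node such that $c$ satisfies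 all equations on the edges of the path, the terminal node is labeled with $z(c)$. The depth of a tree is the maximum number of queries on such a path. Let $h^{(4)}_F(z)$ be the minimum depth of a decision tree over $z$ that solves $z$ relative to $F$ and uses only proper equivalence queries, let $h^{(5)}_F(z)$ be the same minimum for trees that may use both membership queries and proper equivalence queries, and for $i\in\{4,5\}$ and $n\in\mathbb N$ let $h^{(i)}_F(n)=\max\{h^{(i)}_F(z): z \text{ a problem over } F \text{ with } \dim z\le n\}$. Classes of infinite families of concepts: - $\mathcal D$: the families of finite VC-dimension (the cardinalities of the finite sets $S\subseteq U$ with $\{c\cap S:c\in C\}=2^{S}$ are bounded). - $\mathcal C$: the families that are $k$-families of concepts for some $k\in\mathbb N$. Here, for any set $C$ of subsets of $U$ (possibly finite or empty), $(U,C)$ is a $0$-family if each $u\in U$ is constant as a function on $C$ (in particular if $C=\emptyset$), and $(U,C)$ is a $(k+1)$-family if it is not an $m$-family for any $m\le k$ and for every $u\in U$ there are $\delta\in\{0,1\}$ and $m\le k$ such that $(U,\{c\in C:u(c)=\delta\})$ is an $m$-family. - $\mathcal I$: the families for which there is $r\in\mathbb N$ such that each inconsistent system of equations over $F$ has an inconsistent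 subsystem with at most $r$ equations. **Theorem.** Let $F$ be an infinite family of concepts. The minima and maxima above exist, and the following statements hold. (a) If $F\in\mathcal C\cap\mathcal I$, then $h^{(4)}_F(n)=O(1)$ and $h^{(5)}_F(n)=O(1)$. (b) If $F\in(\mathcal D\setminus\mathcal C)\cap\mathcal I$, then $h^{(4)}_F(n)=\Theta(\log n)$, $h^{(5)}_F(n)=\Omega\left(\frac{\log n}{\log\log n}\right)$, and $h^{(5)}_F(n)=O(\log n)$. (c) If $F\in\mathcal D\setminus\mathcal I$ and $i\in\{4,5\}$, then $h^{(i)}_F(n)\ge n-1$ for infinitely many $n\in\mathbb N$, and $h^{(i)}_F(n)\le n$ for every $n\in\mathbb N$. (d) If $F\notin\mathcal D$, then $h^{(4)}_F(n)=n$ and $h^{(5)}_F(n)=n$ for every $n\in\mathbb N$. -/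

import Mathlib

open Filter Asymptotics

namespace ExactLearning

universe v

/-- The value `u(c)` of the function `u : C → {0,1}` given by an element `u`:
it is `1` (`true`) if and only if `u ∈ c`. -/
noncomputable def val {U : Type v} (u : U) (c : Set U) : Bool :=
  open Classical in decide (u ∈ c)

/-- The set of solutions on `C` of a system of equations. The pair `(u, δ)` stands for
the equation `u(x) = δ`, and a system of equations is a set of such pairs. -/
def solutions {U : Type v} (C : Set (Set U)) (S : Set (U × Bool)) : Set (Set U) :=
  {c | c ∈ C ∧ ∀ e ∈ S, val e.1 c = e.2}

/-- A system of equations is consistent on `C` if it has a solution on `C`. -/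
def Consistent {U : Type v} (C : Set (Set U)) (S : Set (U × Bool)) : Prop :=
  (solutions C S).Nonempty

/-- `C(u, δ)`: the concepts `c ∈ C` with `u(c) = δ`. -/
def restrict {U : Type v} (C : Set (Set U)) (u : U) (δ : Bool) : Set (Set U) :=
  {c | c ∈ C ∧ val u c = δ}

/-- The hypothesis `{u₁(x) = δ₁, …, uₙ(x) = δₙ}` over the problem `z = (u₁, …, uₙ)`. -/
def hypothesis {U : Type v} {n : ℕ} (z : Fin n → U) (δ : Fin n → Bool) : Set (U × Bool) :=
  Set.range fun i => (z i, δ i)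

/-- The answer `z(c) = (u₁(c), …, uₙ(c))` of the problem `z` for the concept `c`. -/
noncomputable def answer {U : Type v} {n : ℕ} (z : Fin n → U) (c : Set U) : Fin n → Bool :=
  fun i => val (z i) c

/-- Decision trees over a problem `(u₁, …, uₙ)`. A terminal node carries a tuple; a working
node is a membership query `uᵢ`, with a subtree for each of the two answers, or an equivalence
query with a hypothesis `δ`, with a subtree for the answer that the hypothesis is true and a
subtree for each of the counterexamples `uᵢ(x) = ¬δᵢ`. -/
inductive DecisionTree (n : ℕ) : Type
  | terminal (σ : Fin n → Bool) : DecisionTree n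
  | membership (i : Fin n) (sub : Bool → DecisionTree n) : DecisionTree n
  | equivalence (δ : Fin n → Bool) (yes : DecisionTree n) (sub : Fin n → DecisionTree n) :
      DecisionTree n

/-- `CompletePath z Γ S σ`: the tree `Γ` over `z` has a complete path whose system of equations
(the union of the systems on its edges) is `S` and whose terminal node is labeled `σ`. -/
inductive CompletePath {U : Type v} {n : ℕ} (z : Fin n → U) :
    DecisionTree n → Set (U × Bool) → (Fin n → Bool) → Prop
  | terminal (σ : Fin n → Bool) : CompletePath z (.terminal σ) ∅ σ
  | membership (i : Fin n) (sub : Bool → DecisionTree n) (b : Bool)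
      (S : Set (U × Bool)) (σ : Fin n → Bool) (h : CompletePath z (sub b) S σ) :
      CompletePath z (.membership i sub) ({(z i, b)} ∪ S) σ
  | confirmed (δ : Fin n → Bool) (yes : DecisionTree n) (sub : Fin n → DecisionTree n)
      (S : Set (U × Bool)) (σ : Fin n → Bool) (h : CompletePath z yes S σ) :
      CompletePath z (.equivalence δ yes sub) (hypothesis z δ ∪ S) σ
  | counterexample (δ : Fin n → Bool) (yes : DecisionTree n) (sub : Fin n → DecisionTree n)
      (i : Fin n) (S : Set (U × Bool)) (σ : Fin n → Bool) (h : CompletePath z (sub i) S σ) :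
      CompletePath z (.equivalence δ yes sub) ({(z i, !(δ i))} ∪ S) σ

/-- `Γ` solves the problem `z` relative to `(U, C)`. -/
def Solves {U : Type v} {n : ℕ} (C : Set (Set U)) (z : Fin n → U) (Γ : DecisionTree n) : Prop :=
  ∀ c ∈ C, ∀ (S : Set (U × Bool)) (σ : Fin n → Bool),
    CompletePath z Γ S σ → c ∈ solutions C S → σ = answer z c

/-- The depth: the maximum number of working nodes in a complete path. -/
def DecisionTree.depth {n : ℕ} : DecisionTree n → ℕ
  | .terminal _ => 0
  | .membership _ sub => max (sub false).depth (sub true).depth + 1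
  | .equivalence _ yes sub => max yes.depth (Finset.univ.sup fun i => (sub i).depth) + 1

/-- The two kinds of decision trees: those that use only proper equivalence queries, and those
that use both membership and proper equivalence queries. -/
inductive TreeKind : Type
  | properEq
  | memAndProperEq

/-- All queries of the tree are of the kind `κ`. -/
def Admissible {U : Type v} {n : ℕ} (κ : TreeKind) (C : Set (Set U)) (z : Fin n → U) :
    DecisionTree n → Prop
  | .terminal _ => True
  | .membership _ sub => κ = TreeKind.memAndProperEq ∧ ∀ b, Admissible κ C z (sub b)
  | .equivalence δ yes sub => Consistent C (hypothesis z δ) ∧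
      Admissible κ C z yes ∧ ∀ i, Admissible κ C z (sub i)

/-- The minimum depth of a decision tree of kind `κ` that solves `z` relative to `(U, C)`
(it would be `⊤` if there were no such tree). -/
noncomputable def minDepth {U : Type v} {n : ℕ} (κ : TreeKind) (C : Set (Set U))
    (z : Fin n → U) : ℕ∞ :=
  ⨅ (Γ : DecisionTree n) (_ : Admissible κ C z Γ ∧ Solves C z Γ), (Γ.depth : ℕ∞)

/-- The function of Shannon type: the maximum of `minDepth κ C z` over all problems `z` of
dimension at least `1` and at most `n` (it would be `⊤` if these values were unbounded). -/
noncomputable def shannon {U : Type v} (κ : TreeKind) (C : Set (Set U)) (n : ℕ) : ℕ∞ :=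
  ⨆ (m : ℕ) (_ : 1 ≤ m ∧ m ≤ n) (z : Fin m → U), minDepth κ C z

/-- A finite set `s` of elements is shattered by `C`. -/
def Shattered {U : Type v} (C : Set (Set U)) (s : Finset U) : Prop :=
  ∀ δ : U → Bool, ∃ c ∈ C, ∀ u ∈ s, val u c = δ u

/-- The Vapnik-Chervonenkis dimension. -/
noncomputable def vcDim {U : Type v} (C : Set (Set U)) : ℕ∞ :=
  ⨆ (s : Finset U) (_ : Shattered C s), (s.card : ℕ∞)

/-- The class `D`: finite VC-dimension. -/
def ClassD {U : Type v} (C : Set (Set U)) : Prop :=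
  vcDim C < ⊤

/-- `(U, C)` is a `k`-family of concepts. An empty `C` is a `0`-family, since every
function on it is constant. -/
def IsKFamily {U : Type v} : ℕ → Set (Set U) → Prop
  | 0, C => ∀ u : U, ∃ δ : Bool, ∀ c ∈ C, val u c = δ
  | k + 1, C => (∀ m, (_ : m ≤ k) → ¬ IsKFamily m C) ∧
      ∀ u : U, ∃ δ : Bool, ∃ m, ∃ _ : m ≤ k, IsKFamily m (restrict C u δ)
termination_by k => k
decreasing_by all_goals omega

/-- The class `C`: `k`-families of concepts for some natural `k`. -/
def ClassC {U : Type v} (C : Set (Set U)) : Prop :=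
  ∃ k : ℕ, 1 ≤ k ∧ IsKFamily k C

/-- `(U, C)` is `r`-i-reduced: each (finite) inconsistent system of equations has an
inconsistent subsystem with at most `r` equations. -/
def IsIReduced {U : Type v} (r : ℕ) (C : Set (Set U)) : Prop :=
  ∀ S : Finset (U × Bool), ¬ Consistent C (S : Set (U × Bool)) →
    ∃ T : Finset (U × Bool), T ⊆ S ∧ T.card ≤ r ∧ ¬ Consistent C (T : Set (U × Bool))

/-- The class `I`: `r`-i-reduced for some natural `r`. -/
def ClassI {U : Type v} (C : Set (Set U)) : Prop :=
  ∃ r : ℕ, 1 ≤ r ∧ IsIReduced r C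

end ExactLearning

open ExactLearning

/-!
The values of both functions are games on the *version space* `V ⊆ C` of the concepts that are
compatible with the answers so far.

Upper bounds use equivalence queries only (`Learnable`). Querying a concept of the version space
itself determines one position per counterexample, so `n` queries always suffice. If `C` is
`r`-i-reduced and has finite VC-dimension, then there are polynomially many answers by the
Sauer–Shelah lemma, and the equations that fail on less than a fraction `1 / (r + 1)` of them are
jointly consistent, because any `r` of them are. A concept of `C` that satisfies them all gives a
proper hypothesis each of whose counterexamples removes at least a fraction `1 / (r + 1)` of the
answers (`learnable_of_ncard_mul_pow_le`), whence `O(log n)`. For a `k`-family, each element has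
a value whose refutation lowers `k`. If the hypothesis made of these values is consistent it is
queried; if not, `r` of its equations are already inconsistent, and the version space is a union
of `r` families of smaller level. As strategies for two version spaces can be merged
(`Learnable.union`), induction on `k` gives a bound that does not depend on `n`
(`exists_learnable_of_level`).

Lower bounds are adversary arguments (`lt_minDepth_of_adversary`). On a shattered set the
adversary concedes one position per query. For a minimal inconsistent system of `t` equations,
the adversary always answers according to the system, which is possible because a proper
hypothesis differs from it; this excludes at most one of `t` concepts per query. If `C` is not a
`k`-family for any `k`, then there are complete binary trees of every depth, with nodes from `U`,
all of whose branches are consistent; such a tree of depth `k` has fewer than `2 ^ k` nodes.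
Against equivalence queries alone the adversary descends one level per query. If membership
queries are allowed too, the adversary keeps a set of concepts, initially one for each of the
leaves of a tree of depth `k`: a membership query keeps half of them for one of its answers, and
an equivalence query keeps a fraction of about `1 / k` for one of its counterexamples, since all
but one of the concepts leave the branch selected by the hypothesis at one of its `k` nodes. This
gives `k / log k` queries.
-/

namespace ExactLearning

universe v

variable {U : Type v} {n : ℕ}

/-! ### Decision trees, strategies and adversaries -/

theorem restrict_subset (V : Set (Set U)) (u : U) (b : Bool) : restrict V u b ⊆ V :=
  fun _ h => h.1

theorem restrict_mono {V W : Set (Set U)} (h : V ⊆ W) (u : U) (b : Bool) :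
    restrict V u b ⊆ restrict W u b :=
  fun _ hc => ⟨h hc.1, hc.2⟩

theorem Solves.sub_membership {V : Set (Set U)} {z : Fin n → U} {i : Fin n}
    {sub : Bool → DecisionTree n} (h : Solves V z (.membership i sub)) (b : Bool) :
    Solves (restrict V (z i) b) z (sub b) := by
  intro c hc S σ hp hS
  refine h c hc.1 _ σ (.membership i sub b S σ hp) ⟨hc.1, ?_⟩
  rintro e (rfl | he)
  · exact hc.2
  · exact hS.2 e he

theorem Solves.sub_equivalence {V : Set (Set U)} {z : Fin n → U} {δ : Fin n → Bool}
    {yes : DecisionTree n} {sub : Fin n → DecisionTree n}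
    (h : Solves V z (.equivalence δ yes sub)) (i : Fin n) :
    Solves (restrict V (z i) (!δ i)) z (sub i) := by
  intro c hc S σ hp hS
  refine h c hc.1 _ σ (.counterexample δ yes sub i S σ hp) ⟨hc.1, ?_⟩
  rintro e (rfl | he)
  · exact hc.2
  · exact hS.2 e he

theorem solves_terminal {V : Set (Set U)} {z : Fin n → U} {σ : Fin n → Bool}
    (h : ∀ c ∈ V, answer z c = σ) : Solves V z (.terminal σ) := by
  intro c hc S τ hp _
  cases hp
  exact (h c hc).symm

theorem Solves.answer_eq {V : Set (Set U)} {z : Fin n → U} {σ : Fin n → Bool}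
    (h : Solves V z (.terminal σ)) {c : Set U} (hc : c ∈ V) : answer z c = σ :=
  (h c hc ∅ σ (.terminal σ) ⟨hc, by simp⟩).symm

/-- A confirmed hypothesis determines the answer, so only the counterexamples need subtrees. -/
theorem solves_equivalence {V : Set (Set U)} {z : Fin n → U} {δ : Fin n → Bool}
    {sub : Fin n → DecisionTree n} (h : ∀ i, Solves (restrict V (z i) (!δ i)) z (sub i)) :
    Solves V z (.equivalence δ (.terminal δ) sub) := by
  intro c hc S σ hp hS
  cases hp with
  | confirmed _ _ _ S σ hp =>
    cases hp
    funext i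
    exact (hS.2 (z i, δ i) (Or.inl ⟨i, rfl⟩)).symm
  | counterexample _ _ _ i S σ hp =>
    exact h i c ⟨hc, hS.2 (z i, !δ i) (Or.inl rfl)⟩ S σ hp
      ⟨⟨hc, hS.2 (z i, !δ i) (Or.inl rfl)⟩, fun e he => hS.2 e (Or.inr he)⟩

/-- The problem `z` restricted to hidden concepts in `V` can be solved with at most `d`
equivalence queries whose hypotheses are answers of concepts of `C`. The hypotheses may come
from outside `V`: properness refers to `C`, while `V` shrinks with each counterexample. -/
def Learnable (C : Set (Set U)) (z : Fin n → U) : ℕ → Set (Set U) → Prop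
  | 0, V => ∀ c ∈ V, ∀ c' ∈ V, answer z c = answer z c'
  | d + 1, V => ∃ h ∈ C, ∀ i, Learnable C z d (restrict V (z i) (!val (z i) h))

theorem Learnable.exists_tree {C : Set (Set U)} {z : Fin n → U} (κ : TreeKind) {d : ℕ}
    {V : Set (Set U)} (h : Learnable C z d V) :
    ∃ Γ, Admissible κ C z Γ ∧ Solves V z Γ ∧ Γ.depth ≤ d := by
  induction d generalizing V with
  | zero =>
    rcases V.eq_empty_or_nonempty with rfl | ⟨c, hc⟩
    · exact ⟨.terminal fun _ => true, trivial, solves_terminal (by simp), le_rfl⟩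
    · exact ⟨.terminal (answer z c), trivial, solves_terminal fun c' hc' => h c' hc' c hc, le_rfl⟩
  | succ d ih =>
    obtain ⟨c, hc, hd⟩ := h
    choose sub h1 h2 h3 using fun i => ih (hd i)
    refine ⟨.equivalence (answer z c) (.terminal (answer z c)) sub,
      ⟨⟨c, hc, ?_⟩, trivial, h1⟩, solves_equivalence h2, ?_⟩
    · rintro _ ⟨i, rfl⟩
      rfl
    · simp only [DecisionTree.depth]
      exact Nat.succ_le_succ (max_le (Nat.zero_le _) (Finset.sup_le fun i _ => h3 i))

theorem minDepth_le_of_learnable {C : Set (Set U)} {z : Fin n → U} (κ : TreeKind) {d : ℕ}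
    (h : Learnable C z d C) : minDepth κ C z ≤ d := by
  obtain ⟨Γ, h1, h2, h3⟩ := h.exists_tree κ
  exact (iInf₂_le Γ ⟨h1, h2⟩).trans (by exact_mod_cast h3)

theorem Learnable.mono {C : Set (Set U)} {z : Fin n → U} {d : ℕ} {V W : Set (Set U)}
    (h : Learnable C z d V) (hW : W ⊆ V) : Learnable C z d W := by
  induction d generalizing V W with
  | zero => exact fun c hc c' hc' => h c (hW hc) c' (hW hc')
  | succ d ih =>
    obtain ⟨c, hc, hd⟩ := h
    exact ⟨c, hc, fun i => ih (hd i) (restrict_mono hW _ _)⟩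

theorem learnable_of_const {C : Set (Set U)} (hC : C.Nonempty) {z : Fin n → U} (d : ℕ)
    {V : Set (Set U)} (h : ∀ c ∈ V, ∀ c' ∈ V, answer z c = answer z c') : Learnable C z d V := by
  obtain ⟨c, hc⟩ := hC
  induction d generalizing V with
  | zero => exact h
  | succ d ih => exact ⟨c, hc, fun i => ih fun a ha b hb => h a ha.1 b hb.1⟩

theorem Learnable.mono_depth {C : Set (Set U)} (hC : C.Nonempty) {z : Fin n → U} {d e : ℕ}
    {V : Set (Set U)} (h : Learnable C z d V) (hde : d ≤ e) : Learnable C z e V := by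
  induction d generalizing V e with
  | zero => exact learnable_of_const hC e h
  | succ d ih =>
    obtain ⟨e, rfl⟩ := Nat.exists_eq_add_of_le' (show 1 ≤ e by omega)
    obtain ⟨c, hc, hd⟩ := h
    exact ⟨c, hc, fun i => ih (hd i) (by omega)⟩

/-- Strategies for two version spaces combine: a counterexample to a hypothesis of the strategy
for `V` makes progress in `V` and does no harm in `W`. The extra query rules out the last
remaining answer on `V`. -/
theorem Learnable.union {C : Set (Set U)} {z : Fin n → U} {a b : ℕ} {V W : Set (Set U)}
    (hVC : V ⊆ C) (hV : Learnable C z a V) (hW : Learnable C z b W) (hC : C.Nonempty) :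
    Learnable C z (a + b + 1) (V ∪ W) := by
  induction a generalizing V W with
  | zero =>
    rcases V.eq_empty_or_nonempty with rfl | ⟨c, hc⟩
    · exact Learnable.mono_depth hC (by simpa using hW) (by omega)
    · rw [Nat.zero_add]
      refine ⟨c, hVC hc, fun i => hW.mono ?_⟩
      rintro c' ⟨hc' | hc', hv⟩
      · have : val (z i) c' = val (z i) c := congrFun (hV c' hc' c hc) i
        simp [this] at hv
      · exact hc'
  | succ a ih =>
    obtain ⟨c, hc, hd⟩ := hV
    rw [show a + 1 + b + 1 = (a + b + 1) + 1 by omega]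
    refine ⟨c, hc, fun i => (ih ((restrict_subset _ _ _).trans hVC) (hd i) hW).mono ?_⟩
    rintro c' ⟨hc' | hc', hv⟩
    · exact Or.inl ⟨hc', hv⟩
    · exact Or.inr hc'

theorem learnable_biUnion {C : Set (Set U)} (hC : C.Nonempty) {z : Fin n → U} {ι : Type*}
    (s : Finset ι) {V : ι → Set (Set U)} {f : ℕ} (hVC : ∀ i ∈ s, V i ⊆ C)
    (h : ∀ i ∈ s, Learnable C z f (V i)) :
    Learnable C z (s.card * (f + 1)) (⋃ i ∈ s, V i) := by
  classical
  induction s using Finset.induction_on with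
  | empty => exact learnable_of_const hC _ (by simp)
  | insert a s ha ih =>
    rw [Finset.set_biUnion_insert, Finset.card_insert_of_notMem ha,
      show (s.card + 1) * (f + 1) = f + s.card * (f + 1) + 1 by ring]
    exact (h a (by simp)).union (hVC a (by simp))
      (ih (fun i hi => hVC i (by simp [hi])) fun i hi => h i (by simp [hi])) hC

/-- If the answers on `V` differ only on the positions in `s`, then querying any concept
consistent with the previous counterexamples determines one further position each time. -/
theorem learnable_of_agree_off {C : Set (Set U)} (hC : C.Nonempty) {z : Fin n → U} {d : ℕ}
    {s : Finset (Fin n)} (hs : s.card ≤ d) {V : Set (Set U)} (hVC : V ⊆ C)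
    (h : ∀ c ∈ V, ∀ c' ∈ V, ∀ i ∉ s, val (z i) c = val (z i) c') : Learnable C z d V := by
  induction d generalizing s V with
  | zero =>
    obtain rfl : s = ∅ := by simpa using hs
    exact fun c hc c' hc' => funext fun i => h c hc c' hc' i (by simp)
  | succ d ih =>
    rcases V.eq_empty_or_nonempty with rfl | ⟨c, hc⟩
    · exact learnable_of_const hC _ (by simp)
    · refine ⟨c, hVC hc, fun i => ?_⟩
      by_cases hi : i ∈ s
      · refine ih (s := s.erase i) (by rw [Finset.card_erase_of_mem hi]; omega)
          ((restrict_subset _ _ _).trans hVC) fun a ha b hb j hj => ?_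
        by_cases hji : j = i
        · subst hji
          exact ha.2.trans hb.2.symm
        · exact h a ha.1 b hb.1 j fun hjs => hj (by simp [hji, hjs])
      · refine learnable_of_const hC _ fun a ha => ?_
        have h1 := h a ha.1 c hc i hi
        have h2 := ha.2
        simp [h1] at h2

theorem minDepth_le_dim {C : Set (Set U)} (hC : C.Nonempty) (κ : TreeKind) (z : Fin n → U) :
    minDepth κ C z ≤ n :=
  minDepth_le_of_learnable κ <| learnable_of_agree_off (s := Finset.univ) hC (by simp)
    subset_rfl (by simp)

theorem shannon_le_dim {C : Set (Set U)} (hC : C.Nonempty) (κ : TreeKind) (n : ℕ) :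
    shannon κ C n ≤ n :=
  iSup_le fun m => iSup₂_le fun hm z =>
    (minDepth_le_dim hC κ z).trans (by exact_mod_cast hm.2)

theorem shannon_ne_top {C : Set (Set U)} (hC : C.Nonempty) (κ : TreeKind) (n : ℕ) :
    shannon κ C n ≠ ⊤ :=
  ne_top_of_le_ne_top (ENat.natCast_ne_top n) (shannon_le_dim hC κ n)

theorem minDepth_le_shannon {C : Set (Set U)} (κ : TreeKind) {m : ℕ} (hm : 1 ≤ m) (hmn : m ≤ n)
    (z : Fin m → U) : minDepth κ C z ≤ shannon κ C n :=
  le_iSup_of_le m <| le_iSup₂_of_le ⟨hm, hmn⟩ z le_rfl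

theorem shannon_le_of_learnable {C : Set (Set U)} (κ : TreeKind) {d : ℕ}
    (h : ∀ m, 1 ≤ m → m ≤ n → ∀ z : Fin m → U, Learnable C z d C) : shannon κ C n ≤ d :=
  iSup_le fun m => iSup₂_le fun hm z => minDepth_le_of_learnable κ (h m hm.1 hm.2 z)

/-- The adversary method. `P d V` says that an adversary who has only conceded that the hidden
concept lies in `V` can answer `d` further queries without determining the solution. -/
theorem lt_minDepth_of_adversary {κ : TreeKind} {C : Set (Set U)} {z : Fin n → U}
    (P : ℕ → Set (Set U) → Prop)
    (hdiff : ∀ d V, P d V → ∃ c ∈ V, ∃ c' ∈ V, answer z c ≠ answer z c')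
    (hmem : κ = .memAndProperEq → ∀ d V, P (d + 1) V → ∀ i, ∃ b, P d (restrict V (z i) b))
    (heq : ∀ d V, P (d + 1) V → ∀ δ, Consistent C (hypothesis z δ) →
      ∃ i, P d (restrict V (z i) (!δ i)))
    {d : ℕ} (hP : P d C) : ((d + 1 : ℕ) : ℕ∞) ≤ minDepth κ C z := by
  have key : ∀ (Γ : DecisionTree n) (d : ℕ) (V : Set (Set U)), P d V → Admissible κ C z Γ →
      Solves V z Γ → d + 1 ≤ Γ.depth := by
    intro Γ
    induction Γ with
    | terminal σ =>
      intro d V hV _ hS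
      obtain ⟨c, hc, c', hc', hne⟩ := hdiff d V hV
      exact absurd ((hS.answer_eq hc).trans (hS.answer_eq hc').symm) hne
    | membership i sub ih =>
      intro d V hV hA hS
      cases d with
      | zero => simp [DecisionTree.depth]
      | succ d =>
        obtain ⟨b, hb⟩ := hmem hA.1 d V hV i
        have := ih b d _ hb (hA.2 b) (hS.sub_membership b)
        cases b <;> simp only [DecisionTree.depth] <;> omega
    | equivalence δ yes sub _ ih =>
      intro d V hV hA hS
      cases d with
      | zero => simp [DecisionTree.depth]
      | succ d =>
        obtain ⟨i, hi⟩ := heq d V hV δ hA.1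
        have h1 := ih i d _ hi (hA.2.2 i) (hS.sub_equivalence i)
        have h2 := Finset.le_sup (f := fun i => (sub i).depth) (Finset.mem_univ i)
        simp only [DecisionTree.depth]
        exact Nat.succ_le_succ ((h1.trans h2).trans (le_max_right _ _))
  exact le_iInf₂ fun Γ hΓ => by exact_mod_cast key Γ d C hP hΓ.1 hΓ.2

/-! ### Lower bounds from shattered sets and minimal inconsistent systems -/

theorem Shattered.mono {C : Set (Set U)} {s t : Finset U} (h : Shattered C t) (hst : s ⊆ t) :
    Shattered C s := fun δ =>
  let ⟨c, hc, hδ⟩ := h δ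
  ⟨c, hc, fun u hu => hδ u (hst hu)⟩

theorem exists_shattered_of_not_classD {C : Set (Set U)} (h : ¬ ClassD C) (n : ℕ) :
    ∃ s : Finset U, Shattered C s ∧ s.card = n := by
  by_contra! hne
  refine h (lt_of_le_of_lt (iSup₂_le fun s hs => ?_) (ENat.natCast_lt_top n))
  by_contra! hlt
  obtain ⟨t, ht, hcard⟩ := Finset.exists_subset_card_eq (n := n) (s := s)
    (by exact_mod_cast hlt.le)
  exact hne t (hs.mono ht) hcard

/-- A finite set of elements, enumerated as a problem. -/
theorem exists_problem_of_finset (E : Finset U) :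
    ∃ z : Fin E.card → U, Function.Injective z ∧ Set.range z = E := by
  refine ⟨fun i => E.equivFin.symm i, Subtype.val_injective.comp E.equivFin.symm.injective, ?_⟩
  ext u
  constructor
  · rintro ⟨i, rfl⟩
    exact (E.equivFin.symm i).2
  · intro hu
    exact ⟨E.equivFin ⟨u, hu⟩, by simp⟩

theorem val_eq_of_answer_eq {z : Fin n → U} {c : Set U} {τ : Fin n → Bool}
    (h : answer z c = τ) (i : Fin n) : val (z i) c = τ i :=
  congrFun h i

/-- If every tuple is the answer for some concept, the adversary concedes the value of one
position of `z` per query. -/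
theorem dim_le_minDepth_of_forall_answer {C : Set (Set U)} {z : Fin n → U} (hn : 1 ≤ n)
    (h : ∀ τ, ∃ c ∈ C, answer z c = τ) (κ : TreeKind) : (n : ℕ∞) ≤ minDepth κ C z := by
  -- `s` is the set of positions that are still free, `σ` holds the values conceded elsewhere.
  let P : ℕ → Set (Set U) → Prop := fun d V => ∃ s : Finset (Fin n), d < s.card ∧
    ∃ σ : Fin n → Bool, ∀ τ, (∀ i ∉ s, τ i = σ i) → ∃ c ∈ V, answer z c = τ
  have step : ∀ d V (s : Finset (Fin n)) (σ : Fin n → Bool) (i : Fin n), d + 1 < s.card →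
      (∀ τ, (∀ i ∉ s, τ i = σ i) → ∃ c ∈ V, answer z c = τ) →
      P d (restrict V (z i) (σ i)) := by
    intro d V s σ i hd hV
    refine ⟨s.erase i, ?_, σ, fun τ hτ => ?_⟩
    · have := Finset.pred_card_le_card_erase (s := s) (a := i)
      omega
    · obtain ⟨c, hc, hcτ⟩ := hV τ fun j hj => hτ j fun hj' => hj (Finset.mem_of_mem_erase hj')
      exact ⟨c, ⟨hc, (val_eq_of_answer_eq hcτ i).trans (hτ i (by simp))⟩, hcτ⟩
  have hPC : P (n - 1) C :=
    ⟨Finset.univ, by simp; omega, fun _ => true, fun τ _ => h τ⟩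
  have := lt_minDepth_of_adversary (κ := κ) (z := z) P ?_ ?_ ?_ hPC
  · rwa [Nat.sub_add_cancel hn] at this
  · rintro d V ⟨s, hs, σ, hV⟩
    obtain ⟨i, hi⟩ := Finset.card_pos.mp (by omega : 0 < s.card)
    obtain ⟨c, hc, hcσ⟩ := hV σ fun _ _ => rfl
    obtain ⟨c', hc', hcσ'⟩ := hV (Function.update σ i (!σ i)) fun j hj =>
      Function.update_of_ne (ne_of_mem_of_not_mem hi hj).symm _ _
    refine ⟨c, hc, c', hc', fun heq => ?_⟩
    have := congrFun (hcσ.symm.trans (heq.trans hcσ')) i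
    simp at this
  · rintro _ d V ⟨s, hs, σ, hV⟩ i
    exact ⟨σ i, step d V s σ i hs hV⟩
  · rintro d V ⟨s, hs, σ, hV⟩ δ _
    obtain ⟨i, hi⟩ := Finset.card_pos.mp (by omega : 0 < s.card)
    refine ⟨i, ?_⟩
    have := step d V s (Function.update σ i (!δ i)) i hs fun τ hτ => hV τ fun j hj =>
      (hτ j hj).trans (Function.update_of_ne (ne_of_mem_of_not_mem hi hj).symm _ _)
    rwa [Function.update_self] at this

theorem shannon_eq_dim_of_not_classD {C : Set (Set U)} (hC : C.Nonempty) (h : ¬ ClassD C)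
    (hn : 1 ≤ n) (κ : TreeKind) : shannon κ C n = n := by
  refine le_antisymm (shannon_le_dim hC κ n) ?_
  obtain ⟨s, hs, rfl⟩ := exists_shattered_of_not_classD h n
  obtain ⟨z, hz, hzs⟩ := exists_problem_of_finset s
  refine (dim_le_minDepth_of_forall_answer hn (fun τ => ?_) κ).trans
    (minDepth_le_shannon κ hn le_rfl z)
  obtain ⟨c, hc, hcδ⟩ := hs (Function.extend z τ fun _ => true)
  refine ⟨c, hc, funext fun i => (hcδ (z i) ?_).trans (hz.extend_apply _ _ _)⟩
  exact Finset.mem_coe.mp (hzs ▸ Set.mem_range_self i)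

/-- Let `σ` be inconsistent while every tuple that differs from `σ` in exactly one position is
an answer. The adversary always answers according to `σ`; this is possible for every proper
hypothesis, since it differs from `σ`, and each query excludes at most one of these tuples. -/
theorem pred_dim_le_minDepth_of_minimal_inconsistent {C : Set (Set U)} {z : Fin n → U}
    (hn : 2 ≤ n) {σ : Fin n → Bool} (hσ : ¬ Consistent C (hypothesis z σ))
    (h : ∀ i, ∃ c ∈ C, answer z c = Function.update σ i (!σ i)) (κ : TreeKind) :
    ((n - 1 : ℕ) : ℕ∞) ≤ minDepth κ C z := by
  let P : ℕ → Set (Set U) → Prop := fun d V => ∃ s : Finset (Fin n), d + 1 < s.card ∧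
    ∀ i ∈ s, ∃ c ∈ V, answer z c = Function.update σ i (!σ i)
  have step : ∀ d V (i : Fin n), P (d + 1) V → P d (restrict V (z i) (σ i)) := by
    rintro d V i ⟨s, hs, hV⟩
    refine ⟨s.erase i, ?_, fun j hj => ?_⟩
    · have := Finset.pred_card_le_card_erase (s := s) (a := i)
      omega
    · obtain ⟨c, hc, hcj⟩ := hV j (Finset.mem_of_mem_erase hj)
      refine ⟨c, ⟨hc, (val_eq_of_answer_eq hcj i).trans ?_⟩, hcj⟩
      exact Function.update_of_ne (Finset.ne_of_mem_erase hj).symm _ _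
  have hPC : P (n - 2) C := ⟨Finset.univ, by simp; omega, fun i _ => h i⟩
  have := lt_minDepth_of_adversary (κ := κ) (z := z) P ?_ ?_ ?_ hPC
  · rwa [show n - 2 + 1 = n - 1 by omega] at this
  · rintro d V ⟨s, hs, hV⟩
    obtain ⟨i, hi, j, hj, hij⟩ := Finset.one_lt_card.mp (by omega : 1 < s.card)
    obtain ⟨c, hc, hci⟩ := hV i hi
    obtain ⟨c', hc', hcj⟩ := hV j hj
    refine ⟨c, hc, c', hc', fun heq => ?_⟩
    have := congrFun (hci.symm.trans (heq.trans hcj)) i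
    simp [Function.update_of_ne hij] at this
  · exact fun _ d V hV i => ⟨σ i, step d V i hV⟩
  · intro d V hV δ hδ
    obtain ⟨i, hi⟩ : ∃ i, δ i ≠ σ i := by
      by_contra! hall
      exact hσ (funext hall ▸ hδ)
    refine ⟨i, ?_⟩
    rw [← Bool.eq_not.mpr hi.symm]
    exact step d V i hV

theorem exists_minimal_inconsistent {C : Set (Set U)} (h : ¬ ClassI C) (r : ℕ) :
    ∃ T : Finset (U × Bool), r < T.card ∧ ¬ Consistent C (T : Set (U × Bool)) ∧
      ∀ T' ⊂ T, Consistent C (T' : Set (U × Bool)) := by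
  have hr : ¬ IsIReduced (r + 1) C := fun hr => h ⟨r + 1, by omega, hr⟩
  simp only [IsIReduced] at hr
  push Not at hr
  obtain ⟨S, hS, hsmall⟩ := hr
  obtain ⟨T, hTS, hT⟩ :=
    exists_minimal_le_of_wellFoundedLT (fun T : Finset (U × Bool) =>
      ¬ Consistent C (T : Set (U × Bool))) S hS
  refine ⟨T, ?_, hT.prop, fun T' hT' => by_contra fun hne => hT'.not_subset (hT.le_of_le hne hT'.1)⟩
  by_contra! hle
  exact hT.prop (hsmall T hTS (by omega))

theorem exists_pred_dim_le_shannon_of_not_classI {C : Set (Set U)} (h : ¬ ClassI C)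
    (r : ℕ) (κ : TreeKind) : ∃ n > r, 1 ≤ n ∧ ((n - 1 : ℕ) : ℕ∞) ≤ shannon κ C n := by
  classical
  obtain ⟨T, hcard, hT, hmin⟩ := exists_minimal_inconsistent h (r + 2)
  have hinj : ∀ e ∈ T, ∀ e' ∈ T, e.1 = e'.1 → e = e' := by
    -- Otherwise two contradictory equations form an inconsistent system of size two.
    intro e he e' he' h1
    by_contra hne
    have hsub : ({e, e'} : Finset (U × Bool)) ⊆ T := by
      intro x hx
      rcases Finset.mem_insert.mp hx with rfl | hx
      · exact he
      · exact Finset.mem_singleton.mp hx ▸ he'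
    have hss : ({e, e'} : Finset (U × Bool)) ⊂ T := by
      refine hsub.ssubset_of_ne fun heq => ?_
      have := Finset.card_le_two (a := e) (b := e')
      rw [heq] at this
      omega
    obtain ⟨c, -, hc⟩ := hmin _ hss
    have h2 : val e.1 c = e.2 := hc e (by simp)
    have h3 : val e'.1 c = e'.2 := hc e' (by simp)
    exact hne (Prod.ext h1 (by rw [← h2, ← h3, h1]))
  obtain ⟨p, hp, hpT⟩ := exists_problem_of_finset T
  have hmem : ∀ i, p i ∈ T := fun i => Finset.mem_coe.mp (hpT ▸ Set.mem_range_self i)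
  refine ⟨T.card, by omega, by omega,
    (pred_dim_le_minDepth_of_minimal_inconsistent (z := fun i => (p i).1) (by omega)
      (σ := fun i => (p i).2) ?_ (fun i => ?_) κ).trans
      (minDepth_le_shannon κ (by omega) le_rfl _)⟩
  · rwa [show hypothesis (fun i => (p i).1) (fun i => (p i).2) = T from hpT]
  · obtain ⟨c, hc, hcT⟩ := hmin _ (Finset.erase_ssubset (hmem i))
    refine ⟨c, hc, funext fun j => ?_⟩
    have hother : ∀ j ≠ i, val (p j).1 c = (p j).2 := fun j hj =>
      hcT (p j) (by simpa [hmem j] using hp.ne hj)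
    by_cases hj : j = i
    · subst hj
      rw [Function.update_self]
      refine Bool.eq_not.mpr fun heq => hT ⟨c, hc, fun e he => ?_⟩
      obtain ⟨l, rfl⟩ : e ∈ Set.range p := hpT ▸ he
      by_cases hl : l = j
      · exact hl ▸ heq
      · exact hother l hl
    · rw [Function.update_of_ne hj]
      exact hother j hj

/-! ### Levels of families and bounded strategies -/

/-- Every `u ∈ E` has a value `δ` such that `V` restricted to `u(x) = δ` has smaller level;
at level `0` every `u ∈ E` is constant on `V`. With `E = Set.univ` this says that `V` is an
`m`-family for some `m ≤ k`. Failure of `Level E k V` says that there is a complete binary tree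
of depth `k + 1` with nodes from `E`, all of whose branches are consistent on `V`. -/
def Level (E : Set U) : ℕ → Set (Set U) → Prop
  | 0, V => ∀ u ∈ E, ∃ δ, ∀ c ∈ V, val u c = δ
  | k + 1, V => ∀ u ∈ E, ∃ δ, Level E k (restrict V u δ)

theorem Level.mono {E : Set U} {k : ℕ} {V W : Set (Set U)} (h : Level E k V) (hW : W ⊆ V) :
    Level E k W := by
  induction k generalizing V W with
  | zero => exact fun u hu => (h u hu).imp fun δ hδ c hc => hδ c (hW hc)
  | succ k ih => exact fun u hu => (h u hu).imp fun δ hδ => ih hδ (restrict_mono hW u δ)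

theorem Level.mono_elements {E E' : Set U} {k : ℕ} {V : Set (Set U)} (h : Level E' k V)
    (hE : E ⊆ E') : Level E k V := by
  induction k generalizing V with
  | zero => exact fun u hu => h u (hE hu)
  | succ k ih => exact fun u hu => (h u (hE hu)).imp fun δ hδ => ih hδ

theorem Level.succ {E : Set U} {k : ℕ} {V : Set (Set U)} (h : Level E k V) :
    Level E (k + 1) V := by
  induction k generalizing V with
  | zero => exact fun u _ => ⟨true, h.mono (restrict_subset V u true)⟩
  | succ k ih => exact fun u hu => (h u hu).imp fun δ hδ => ih hδ

theorem Level.mono_level {E : Set U} {k l : ℕ} (hkl : k ≤ l) {V : Set (Set U)}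
    (h : Level E k V) : Level E l V := by
  induction l, hkl using Nat.le_induction with
  | base => exact h
  | succ l _ ih => exact ih.succ

theorem IsKFamily.level {k : ℕ} {V : Set (Set U)} (h : IsKFamily k V) :
    Level Set.univ k V := by
  induction k using Nat.strong_induction_on generalizing V with
  | _ k ih =>
    cases k with
    | zero =>
      rw [IsKFamily] at h
      exact fun u _ => h u
    | succ k =>
      rw [IsKFamily] at h
      intro u _
      obtain ⟨δ, m, hm, hδ⟩ := h.2 u
      exact ⟨δ, (ih m (by omega) hδ).mono_level hm⟩

theorem Level.exists_isKFamily {k : ℕ} {V : Set (Set U)} (h : Level Set.univ k V) :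
    ∃ m ≤ k, IsKFamily m V := by
  induction k generalizing V with
  | zero =>
    refine ⟨0, le_rfl, ?_⟩
    rw [IsKFamily]
    exact fun u => h u trivial
  | succ k ih =>
    by_cases hk : ∃ m ≤ k, IsKFamily m V
    · exact hk.imp fun m hm => ⟨by omega, hm.2⟩
    · push Not at hk
      refine ⟨k + 1, le_rfl, ?_⟩
      rw [IsKFamily]
      refine ⟨hk, fun u => ?_⟩
      obtain ⟨δ, hδ⟩ := h u trivial
      obtain ⟨m, hm, hm'⟩ := ih hδ
      exact ⟨δ, m, hm, hm'⟩

theorem not_isKFamily_zero {C : Set (Set U)} (hC : C.Infinite) : ¬ IsKFamily 0 C := by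
  intro h
  rw [IsKFamily] at h
  refine hC (Set.Subsingleton.finite fun c hc c' hc' => ?_)
  ext u
  obtain ⟨δ, hδ⟩ := h u
  have := (hδ c hc).trans (hδ c' hc').symm
  simpa [val] using this

theorem not_level_of_not_classC {C : Set (Set U)} (hC : C.Infinite) (h : ¬ ClassC C) (k : ℕ) :
    ¬ Level Set.univ k C := by
  intro hk
  obtain ⟨m, -, hm⟩ := hk.exists_isKFamily
  rcases Nat.eq_zero_or_pos m with rfl | hm0
  · exact not_isKFamily_zero hC hm
  · exact h ⟨m, hm0, hm⟩

theorem IsIReduced.restrict {r : ℕ} {V : Set (Set U)} (h : IsIReduced r V) (u : U) (δ : Bool) :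
    IsIReduced r (restrict V u δ) := by
  classical
  intro S hS
  obtain ⟨T, hTS, hcard, hT⟩ := h (insert (u, δ) S) (by
    rintro ⟨c, hc, hcS⟩
    exact hS ⟨c, ⟨hc, hcS (u, δ) (by simp)⟩, fun e he => hcS e (by simp_all)⟩)
  refine ⟨T.erase (u, δ), ?_, (Finset.card_erase_le).trans hcard, ?_⟩
  · intro e he
    exact (Finset.mem_insert.mp (hTS (Finset.mem_of_mem_erase he))).resolve_left
      (Finset.ne_of_mem_erase he)
  · rintro ⟨c, hc, hcT⟩
    refine hT ⟨c, hc.1, fun e he => ?_⟩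
    by_cases hne : e = (u, δ)
    · exact hne ▸ hc.2
    · exact hcT e (by simpa [hne] using he)

theorem eq_biUnion_restrict_of_not_consistent {V : Set (Set U)} {T : Finset (U × Bool)}
    (hT : ¬ Consistent V (T : Set (U × Bool))) : V = ⋃ e ∈ T, restrict V e.1 (!e.2) := by
  refine Set.Subset.antisymm (fun c hc => ?_) (Set.iUnion₂_subset fun e _ => restrict_subset _ _ _)
  by_contra hne
  refine hT ⟨c, hc, fun e he => ?_⟩
  by_contra hval
  exact hne (Set.mem_biUnion he ⟨hc, Bool.eq_not.mpr hval⟩)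

/-- On a version space of level `k + 1` each `u` has a value `¬δ` whose refutation lowers the
level. If these values form a consistent hypothesis, it is queried. Otherwise already `r` of
these equations are inconsistent, so the version space is a union of `r` spaces of level `k`. -/
theorem exists_learnable_of_level (r k : ℕ) : ∃ d, ∀ (C : Set (Set U)), C.Nonempty →
    ∀ (n : ℕ) (z : Fin n → U), ∀ V ⊆ C, IsIReduced r V → Level Set.univ k V →
      Learnable C z d V := by
  classical
  induction k with
  | zero =>
    refine ⟨0, fun C _ n z V _ _ h c hc c' hc' => funext fun i => ?_⟩
    obtain ⟨δ, hδ⟩ := h (z i) trivial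
    exact (hδ c hc).trans (hδ c' hc').symm
  | succ k ih =>
    obtain ⟨d, hd⟩ := ih
    refine ⟨(r + 1) * (d + 1), fun C hC n z V hVC hr h => ?_⟩
    choose δ hδ using fun u => h u trivial
    have hlearn : ∀ u, Learnable C z d (restrict V u (δ u)) := fun u =>
      hd C hC n z _ ((restrict_subset _ _ _).trans hVC) (hr.restrict u (δ u)) (hδ u)
    by_cases hcons : Consistent V
        ((Finset.univ.image fun i => (z i, !δ (z i)) : Finset (U × Bool)) : Set (U × Bool))
    · obtain ⟨c, hc, hcS⟩ := hcons
      refine Learnable.mono_depth (d := d + 1) hC ⟨c, hVC hc, fun i => ?_⟩ (by nlinarith)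
      have : val (z i) c = !δ (z i) := hcS (z i, !δ (z i))
        (Finset.mem_coe.mpr (Finset.mem_image_of_mem _ (Finset.mem_univ i)))
      rw [this, Bool.not_not]
      exact hlearn (z i)
    · obtain ⟨T, hTS, hcard, hT⟩ := hr _ hcons
      rw [eq_biUnion_restrict_of_not_consistent hT]
      refine (learnable_biUnion hC T (fun e _ => (restrict_subset _ _ _).trans hVC)
        fun e he => ?_).mono_depth hC (Nat.mul_le_mul_right _ (by omega : T.card ≤ r + 1))
      obtain ⟨i, -, rfl⟩ := Finset.mem_image.mp (hTS he)
      rw [Bool.not_not]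
      exact hlearn (z i)

theorem exists_shannon_le_of_classC_classI {C : Set (Set U)} (hC : C.Nonempty) (h : ClassC C)
    (hI : ClassI C) (κ : TreeKind) : ∃ d : ℕ, ∀ n, shannon κ C n ≤ d := by
  obtain ⟨k, -, hk⟩ := h
  obtain ⟨r, -, hr⟩ := hI
  obtain ⟨d, hd⟩ := exists_learnable_of_level (U := U) r k
  exact ⟨d, fun n => shannon_le_of_learnable κ fun m _ _ z =>
    hd C hC m z C subset_rfl hr hk.level⟩

/-! ### Halving with proper hypotheses and the Sauer–Shelah bound -/

theorem ncard_answer_restrict_add (V : Set (Set U)) (z : Fin n → U) (i : Fin n) (b : Bool) :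
    (answer z '' restrict V (z i) b).ncard + (answer z '' restrict V (z i) (!b)).ncard =
      (answer z '' V).ncard := by
  rw [← Set.ncard_union_eq _ (Set.toFinite _) (Set.toFinite _), ← Set.image_union]
  · congr 2
    ext c
    constructor
    · rintro (h | h) <;> exact h.1
    · intro h
      by_cases hb : val (z i) c = b
      · exact Or.inl ⟨h, hb⟩
      · exact Or.inr ⟨h, Bool.eq_not.mpr hb⟩
  · rw [Set.disjoint_left]
    rintro _ ⟨c, hc, rfl⟩ ⟨c', hc', heq⟩
    have h1 : val (z i) c' = val (z i) c := congrFun heq i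
    rw [hc.2, hc'.2] at h1
    cases b <;> simp at h1

/-- The overwhelming majority votes: if each equation of `T` is violated by fewer than a fraction
`1 / (r + 1)` of the answers on `V`, then any `r` of them have a common solution. -/
theorem consistent_of_rare_violations {C : Set (Set U)} {r : ℕ} (hr : IsIReduced r C)
    {z : Fin n → U} {V : Set (Set U)} (hVC : V ⊆ C) (hV : V.Nonempty) (T : Finset (U × Bool))
    (hT : ∀ e ∈ T, (r + 1) * (answer z '' restrict V e.1 (!e.2)).ncard ≤ (answer z '' V).ncard) :
    Consistent C (T : Set (U × Bool)) := by
  by_contra hne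
  obtain ⟨T', hT'T, hcard, hT'⟩ := hr T hne
  have hT'V : ¬ Consistent V (T' : Set (U × Bool)) := fun ⟨c, hc, hcT⟩ => hT' ⟨c, hVC hc, hcT⟩
  have hpos : 0 < (answer z '' V).ncard := (Set.ncard_pos (Set.toFinite _)).mpr (hV.image _)
  have hle : (answer z '' V).ncard ≤ ∑ e ∈ T', (answer z '' restrict V e.1 (!e.2)).ncard := by
    refine le_trans (le_of_eq ?_) (Finset.set_ncard_biUnion_le T' _)
    conv_lhs => rw [eq_biUnion_restrict_of_not_consistent hT'V]
    simp only [Set.image_iUnion]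
  have hsum : (r + 1) * (answer z '' V).ncard ≤ r * (answer z '' V).ncard :=
    calc (r + 1) * (answer z '' V).ncard
        ≤ ∑ e ∈ T', (r + 1) * (answer z '' restrict V e.1 (!e.2)).ncard := by
          rw [← Finset.mul_sum]
          exact Nat.mul_le_mul_left _ hle
      _ ≤ ∑ _e ∈ T', (answer z '' V).ncard := Finset.sum_le_sum fun e he => hT e (hT'T he)
      _ ≤ r * (answer z '' V).ncard := by
          rw [Finset.sum_const, smul_eq_mul]
          exact Nat.mul_le_mul_right _ hcard
  nlinarith

/-- Halving with proper hypotheses: querying a concept that agrees with all overwhelming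
majorities, each counterexample removes at least a fraction `1 / (r + 1)` of the answers. -/
theorem learnable_of_ncard_mul_pow_le {C : Set (Set U)} (hC : C.Nonempty) {r : ℕ}
    (hr : IsIReduced r C) (z : Fin n → U) {d : ℕ} {V : Set (Set U)} (hVC : V ⊆ C)
    (hV : (answer z '' V).ncard * r ^ d ≤ (r + 1) ^ d) : Learnable C z d V := by
  classical
  induction d generalizing V with
  | zero =>
    intro c hc c' hc'
    have hsub : (answer z '' V).Subsingleton := by simpa using hV
    exact hsub (Set.mem_image_of_mem _ hc) (Set.mem_image_of_mem _ hc')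
  | succ d ih =>
    rcases V.eq_empty_or_nonempty with rfl | hne
    · exact learnable_of_const hC _ (by simp)
    let T : Finset (U × Bool) := (Finset.univ.image fun p : Fin n × Bool => (z p.1, p.2)).filter
      fun e => (r + 1) * (answer z '' restrict V e.1 (!e.2)).ncard ≤ (answer z '' V).ncard
    obtain ⟨c, hc, hcT⟩ := consistent_of_rare_violations hr hVC hne T
      fun e he => (Finset.mem_filter.mp he).2
    refine ⟨c, hc, fun i => ih ((restrict_subset _ _ _).trans hVC) ?_⟩
    have hshrink : (r + 1) * (answer z '' restrict V (z i) (!val (z i) c)).ncard ≤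
        r * (answer z '' V).ncard := by
      by_contra! hlt
      -- Then the value opposite to that of `c` holds for the overwhelming majority.
      have hadd := ncard_answer_restrict_add V z i (val (z i) c)
      have hmem : (z i, !val (z i) c) ∈ T := by
        refine Finset.mem_filter.mpr ⟨by simp, ?_⟩
        simp only [Bool.not_not]
        nlinarith
      have := hcT _ hmem
      simp at this
    have h1 : (r + 1) * ((answer z '' restrict V (z i) (!val (z i) c)).ncard * r ^ d) ≤
        (r + 1) * (r + 1) ^ d :=
      calc _ = (r + 1) * (answer z '' restrict V (z i) (!val (z i) c)).ncard * r ^ d := by ring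
        _ ≤ r * (answer z '' V).ncard * r ^ d := Nat.mul_le_mul_right _ hshrink
        _ = (answer z '' V).ncard * r ^ (d + 1) := by ring
        _ ≤ _ := by rwa [← pow_succ']
    exact Nat.le_of_mul_le_mul_left h1 (Nat.succ_pos r)

theorem two_mul_pow_le_succ_pow {r : ℕ} (hr : 1 ≤ r) : 2 * r ^ r ≤ (r + 1) ^ r := by
  obtain ⟨s, rfl⟩ := Nat.exists_eq_add_of_le' hr
  have h := pow_add_mul_le_add_pow (a := s + 1) (b := 1) (by omega) (by omega) (s + 1)
  simp only [Nat.add_sub_cancel, Nat.cast_id, mul_one, ← pow_succ'] at h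
  omega

/-- The Sauer–Shelah bound for the number of answers of a problem. -/
theorem ncard_answer_le {C : Set (Set U)} {d : ℕ}
    (hd : ∀ s : Finset U, Shattered C s → s.card ≤ d) (z : Fin n → U) :
    (answer z '' C).ncard ≤ (n + 1) ^ d := by
  classical
  let 𝒜 : Finset (Finset (Fin n)) := Finset.univ.filter fun t =>
    ∃ c ∈ C, ∀ i, i ∈ t ↔ val (z i) c = true
  have hle : (answer z '' C).ncard ≤ 𝒜.card := by
    have hsub : answer z '' C ⊆ 𝒜.image fun t i => decide (i ∈ t) := by
      rintro _ ⟨c, hc, rfl⟩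
      rw [Finset.mem_coe, Finset.mem_image]
      refine ⟨Finset.univ.filter fun i => val (z i) c = true,
        Finset.mem_filter.mpr ⟨Finset.mem_univ _, c, hc, by simp⟩, ?_⟩
      funext i
      simp [answer]
    calc (answer z '' C).ncard ≤ _ := Set.ncard_le_ncard hsub (Finset.finite_toSet _)
      _ ≤ 𝒜.card := by
        rw [Set.ncard_coe_finset]
        exact Finset.card_image_le
  have hvc : 𝒜.vcDim ≤ d := by
    refine Finset.sup_le fun t ht => ?_
    rw [Finset.mem_shatterer] at ht
    have hinj : Set.InjOn z t := by
      intro i hi j hj hij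
      obtain ⟨u, hu, htu⟩ := ht.exists_inter_eq_singleton hi
      obtain ⟨c, -, hc⟩ := (Finset.mem_filter.mp hu).2
      have hiu : i ∈ u := Finset.mem_of_mem_inter_right (htu ▸ Finset.mem_singleton_self i)
      have hju : j ∈ u := (hc j).mpr (hij ▸ (hc i).mp hiu)
      exact (Finset.mem_singleton.mp (htu ▸ Finset.mem_inter.mpr ⟨hj, hju⟩)).symm
    rw [← Finset.card_image_of_injOn hinj]
    refine hd _ fun δ => ?_
    obtain ⟨u, hu, htu⟩ := ht (Finset.filter_subset (fun i => δ (z i) = true) t)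
    obtain ⟨c, hc, hcu⟩ := (Finset.mem_filter.mp hu).2
    refine ⟨c, hc, fun x hx => ?_⟩
    obtain ⟨i, hi, rfl⟩ := Finset.mem_image.mp hx
    rw [Bool.eq_iff_iff, ← hcu i]
    have := Finset.ext_iff.mp htu i
    simpa [hi] using this
  calc (answer z '' C).ncard ≤ 𝒜.card := hle
    _ ≤ ∑ k ∈ Finset.Iic 𝒜.vcDim, n.choose k := by
      simpa using 𝒜.card_le_card_shatterer.trans Finset.card_shatterer_le_sum_vcDim
    _ ≤ ∑ k ∈ Finset.range (d + 1), n ^ k * 1 ^ (d - k) * d.choose k := by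
      refine (Finset.sum_le_sum_of_subset (t := Finset.range (d + 1)) fun k hk => ?_).trans
        (Finset.sum_le_sum fun k hk => ?_)
      · have := Finset.mem_Iic.mp hk
        exact Finset.mem_range.mpr (by omega)
      · rw [one_pow, mul_one]
        exact (Nat.choose_le_pow n k).trans (Nat.le_mul_of_pos_right _
          (Nat.choose_pos (Nat.lt_succ_iff.mp (Finset.mem_range.mp hk))))
    _ = (n + 1) ^ d := (add_pow n 1 d).symm

theorem exists_shannon_le_clog {C : Set (Set U)} (hC : C.Nonempty) (hD : ClassD C)
    (hI : ClassI C) (κ : TreeKind) :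
    ∃ a : ℕ, ∀ n, shannon κ C n ≤ ((a * Nat.clog 2 (n + 1) : ℕ) : ℕ∞) := by
  obtain ⟨r, hr1, hr⟩ := hI
  obtain ⟨d, hd⟩ := ENat.ne_top_iff_exists.mp (ne_of_lt hD)
  have hshat : ∀ s : Finset U, Shattered C s → s.card ≤ d := fun s hs => by
    have : (s.card : ℕ∞) ≤ vcDim C := le_iSup₂_of_le s hs le_rfl
    rw [← hd] at this
    exact_mod_cast this
  refine ⟨r * d, fun n => shannon_le_of_learnable κ fun m _ hmn z =>
    learnable_of_ncard_mul_pow_le hC hr z subset_rfl ?_⟩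
  set l := Nat.clog 2 (n + 1)
  calc (answer z '' C).ncard * r ^ (r * d * l) ≤ 2 ^ (d * l) * r ^ (r * d * l) := by
        refine Nat.mul_le_mul_right _ ?_
        calc (answer z '' C).ncard ≤ (m + 1) ^ d := ncard_answer_le hshat z
          _ ≤ (2 ^ l) ^ d := Nat.pow_le_pow_left
              ((Nat.succ_le_succ hmn).trans (Nat.le_pow_clog one_lt_two _)) d
          _ = 2 ^ (d * l) := by rw [← pow_mul, mul_comm]
    _ = (2 * r ^ r) ^ (d * l) := by rw [mul_pow, ← pow_mul, mul_assoc]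
    _ ≤ ((r + 1) ^ r) ^ (d * l) := Nat.pow_le_pow_left (two_mul_pow_le_succ_pow hr1) _
    _ = (r + 1) ^ (r * d * l) := by rw [← pow_mul, mul_assoc]

/-! ### Lower bounds from binary trees of unbounded depth -/

/-- Finitely many elements witness that the level exceeds `k`: the nodes of a complete binary
tree of depth `k + 1`. -/
theorem exists_finset_not_level {k : ℕ} {V : Set (Set U)} (h : ¬ Level Set.univ k V) :
    ∃ E : Finset U, E.card + 1 ≤ 2 ^ (k + 1) ∧ ¬ Level (E : Set U) k V := by
  classical
  induction k generalizing V with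
  | zero =>
    simp only [Level] at h
    push Not at h
    obtain ⟨u, -, hu⟩ := h
    refine ⟨{u}, by simp, fun hE => ?_⟩
    obtain ⟨δ, hδ⟩ := hE u (by simp)
    obtain ⟨c, hc, hne⟩ := hu δ
    exact hne (hδ c hc)
  | succ k ih =>
    simp only [Level] at h
    push Not at h
    obtain ⟨u, -, hu⟩ := h
    choose E hcard hE using fun δ => ih (hu δ)
    refine ⟨insert u (E true ∪ E false), ?_, fun hlevel => ?_⟩
    · have h1 := Finset.card_insert_le u (E true ∪ E false)
      have h2 := Finset.card_union_le (E true) (E false)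
      have h3 := hcard true
      have h4 := hcard false
      rw [pow_succ]
      omega
    · obtain ⟨δ, hδ⟩ := hlevel u (by simp)
      refine hE δ (hδ.mono_elements fun x hx => ?_)
      cases δ <;> simp_all

theorem exists_answer_ne_of_not_level {z : Fin n → U} {k : ℕ} {V : Set (Set U)}
    (h : ¬ Level (Set.range z) k V) : ∃ c ∈ V, ∃ c' ∈ V, answer z c ≠ answer z c' := by
  by_contra! hall
  refine h (Level.mono_level (Nat.zero_le k) ?_)
  rintro _ ⟨i, rfl⟩
  rcases V.eq_empty_or_nonempty with rfl | ⟨c, hc⟩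
  · exact ⟨true, by simp⟩
  · exact ⟨val (z i) c, fun c' hc' => congrFun (hall c' hc' c hc) i⟩

/-- The adversary refutes each hypothesis at the element of the root of a binary tree that
witnesses the level. -/
theorem lt_minDepth_of_not_level {C : Set (Set U)} {z : Fin n → U} {k : ℕ}
    (h : ¬ Level (Set.range z) k C) : ((k + 1 : ℕ) : ℕ∞) ≤ minDepth .properEq C z := by
  refine lt_minDepth_of_adversary (κ := .properEq) (fun d V => ¬ Level (Set.range z) d V)
    (fun d V hV => exists_answer_ne_of_not_level hV) (fun hκ => absurd hκ (by simp))
    (fun d V hV δ _ => ?_) h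
  by_contra! hall
  refine hV ?_
  rintro _ ⟨i, rfl⟩
  exact ⟨!δ i, hall i⟩

/-- The concepts in `A` are identified by a binary tree of depth at most `k` whose nodes are
membership tests for elements of `E`. -/
def Identifies (E : Set U) : ℕ → Finset (Set U) → Prop
  | 0, A => A.card ≤ 1
  | k + 1, A => ∃ u ∈ E, ∀ b, Identifies E k (A.filter fun c => val u c = b)

theorem Identifies.mono {E : Set U} {k : ℕ} {A B : Finset (Set U)} (h : Identifies E k A)
    (hB : B ⊆ A) : Identifies E k B := by
  induction k generalizing A B with
  | zero => exact (Finset.card_le_card hB).trans h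
  | succ k ih =>
    obtain ⟨u, hu, hb⟩ := h
    exact ⟨u, hu, fun b => ih (hb b) (Finset.filter_subset_filter _ hB)⟩

theorem exists_identifies_of_not_level {E : Set U} {k : ℕ} {V : Set (Set U)}
    (h : ¬ Level E k V) :
    ∃ A : Finset (Set U), (A : Set (Set U)) ⊆ V ∧ A.card = 2 ^ k ∧ Identifies E k A := by
  classical
  induction k generalizing V with
  | zero =>
    simp only [Level] at h
    push Not at h
    obtain ⟨u, -, hu⟩ := h
    obtain ⟨c, hc, -⟩ := hu true
    exact ⟨{c}, by simpa using hc, by simp, by simp [Identifies]⟩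
  | succ k ih =>
    simp only [Level] at h
    push Not at h
    obtain ⟨u, huE, hu⟩ := h
    choose A hAV hcard hA using fun δ => ih (hu δ)
    have hfilter : ∀ b, (A true ∪ A false).filter (fun c => val u c = b) = A b := by
      intro b
      ext c
      have h1 : ∀ δ, c ∈ A δ → val u c = δ := fun δ hc => (hAV δ hc).2
      cases b <;> grind
    refine ⟨A true ∪ A false, ?_, ?_, u, huE, fun b => (hfilter b).symm ▸ hA b⟩
    · rw [Finset.coe_union]
      exact Set.union_subset ((hAV true).trans (restrict_subset _ _ _))
        ((hAV false).trans (restrict_subset _ _ _))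
    · rw [Finset.card_union_of_disjoint, hcard, hcard, pow_succ, mul_two]
      refine Finset.disjoint_left.mpr fun c h1 h2 => ?_
      have := (hAV true h1).2.symm.trans (hAV false h2).2
      simp at this

/-- The hypothesis `δ` selects a branch of the identification tree. All concepts of `A` but at
most one leave this branch, each at one of its `k` nodes, so some counterexample retains at
least `(A.card - 1) / k` concepts. -/
theorem Identifies.card_le {z : Fin n → U} {k M : ℕ} {A : Finset (Set U)}
    (h : Identifies (Set.range z) k A) (δ : Fin n → Bool)
    (hM : ∀ i, (A.filter fun c => val (z i) c = !δ i).card ≤ M) : A.card ≤ 1 + k * M := by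
  induction k generalizing A with
  | zero => simpa [Identifies] using h
  | succ k ih =>
    obtain ⟨_, ⟨i, rfl⟩, hb⟩ := h
    have h1 := ih (hb (δ i)) fun j => (Finset.card_le_card
      (Finset.filter_subset_filter _ (Finset.filter_subset _ _))).trans (hM j)
    have h2 := Finset.card_filter_add_card_filter_not (s := A) (fun c => val (z i) c = δ i)
    have h3 := hM i
    simp only [← Bool.eq_not] at h2
    rw [← h2]
    linarith

/-- Each query lets the adversary retain at least a fraction `1 / (k + 1)` of the concepts:
half of them for a membership query, and those given by `Identifies.card_le` for an equivalence
query. -/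
theorem lt_minDepth_of_identifies {C : Set (Set U)} {z : Fin n → U} {k d : ℕ} (hk : 1 ≤ k)
    {A : Finset (Set U)} (hAC : (A : Set (Set U)) ⊆ C) (hA : Identifies (Set.range z) k A)
    (hcard : 2 * (k + 1) ^ d ≤ A.card) (κ : TreeKind) :
    ((d + 1 : ℕ) : ℕ∞) ≤ minDepth κ C z := by
  let P : ℕ → Set (Set U) → Prop := fun d V => ∃ A : Finset (Set U), (A : Set (Set U)) ⊆ V ∧
    Identifies (Set.range z) k A ∧ 2 * (k + 1) ^ d ≤ A.card
  have step : ∀ {d V} {A : Finset (Set U)} {i b}, (A : Set (Set U)) ⊆ V →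
      Identifies (Set.range z) k A →
      2 * (k + 1) ^ d ≤ (A.filter fun c => val (z i) c = b).card →
      P d (restrict V (z i) b) := by
    refine fun hAV hA hle => ⟨_, fun c hc => ?_, hA.mono (Finset.filter_subset _ _), hle⟩
    have := Finset.mem_filter.mp hc
    exact ⟨hAV this.1, this.2⟩
  refine lt_minDepth_of_adversary P ?_ ?_ ?_ ⟨A, hAC, hA, hcard⟩
  · rintro d V ⟨A, hAV, hA, hle⟩
    by_contra! hall
    have h2 : 2 ≤ A.card := (Nat.le_mul_of_pos_right 2 (by positivity)).trans hle
    obtain ⟨c, hc⟩ := Finset.card_pos.mp (by omega : 0 < A.card)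
    have := hA.card_le (M := 0) (answer z c) fun i => by
      rw [Nat.le_zero, Finset.card_eq_zero, Finset.filter_eq_empty_iff]
      intro c' hc' hne
      exact Bool.eq_not.mp hne (congrFun (hall c' (hAV hc') c (hAV hc)) i)
    omega
  · rintro - d V ⟨A, hAV, hA, hle⟩ i
    by_contra! hall
    have h1 := fun b => mt (step (i := i) (b := b) hAV hA) (hall b)
    have h2 := Finset.card_filter_add_card_filter_not (s := A) (fun c => val (z i) c = true)
    have h3 := h1 true
    have h4 := h1 false
    simp only [Bool.not_eq_true] at h2
    have h5 : 4 * (k + 1) ^ d ≤ 2 * (k + 1) ^ (d + 1) := by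
      rw [pow_succ]
      nlinarith [Nat.pow_pos (n := d) (Nat.succ_pos k)]
    omega
  · rintro d V ⟨A, hAV, hA, hle⟩ δ _
    by_contra! hall
    have hpos : 0 < (k + 1) ^ d := by positivity
    have h1 := hA.card_le (M := 2 * (k + 1) ^ d) δ fun i =>
      (not_le.mp (mt (step (i := i) (b := !δ i) hAV hA) (hall i))).le
    rw [pow_succ] at hle
    nlinarith

theorem exists_problem_not_level {C : Set (Set U)} (hC : C.Infinite) (h : ¬ ClassC C) {k : ℕ}
    (hn : 2 ^ (k + 1) ≤ n) :
    ∃ m, 1 ≤ m ∧ m ≤ n ∧ ∃ z : Fin m → U, ¬ Level (Set.range z) k C := by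
  obtain ⟨E, hcard, hE⟩ := exists_finset_not_level (not_level_of_not_classC hC h k)
  obtain ⟨z, -, hz⟩ := exists_problem_of_finset E
  refine ⟨E.card, Finset.card_pos.mpr ?_, by omega, z, hz ▸ hE⟩
  rw [Finset.nonempty_iff_ne_empty]
  rintro rfl
  cases k <;> simp [Level] at hE

theorem natLog_le_shannon_properEq {C : Set (Set U)} (hC : C.Infinite) (h : ¬ ClassC C)
    (hn : 2 ≤ n) : (Nat.log 2 n : ℕ∞) ≤ shannon .properEq C n := by
  have hlog : 1 ≤ Nat.log 2 n := Nat.log_pos one_lt_two hn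
  obtain ⟨k, hk⟩ := Nat.exists_eq_add_of_le' hlog
  obtain ⟨m, hm, hmn, z, hz⟩ := exists_problem_not_level (n := n) (k := k) hC h
    (hk ▸ Nat.pow_log_le_self 2 (by omega))
  rw [hk]
  exact (lt_minDepth_of_not_level hz).trans (minDepth_le_shannon _ hm hmn z)

theorem natLog_div_le_shannon {C : Set (Set U)} (hC : C.Infinite) (h : ¬ ClassC C)
    (hn : 4 ≤ n) (κ : TreeKind) :
    (((Nat.log 2 n - 2) / (Nat.log 2 (Nat.log 2 n) + 1) + 1 : ℕ) : ℕ∞) ≤ shannon κ C n := by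
  have hlog : 2 ≤ Nat.log 2 n := (Nat.le_log_iff_pow_le one_lt_two (by omega)).mpr (by omega)
  obtain ⟨k, hk⟩ := Nat.exists_eq_add_of_le' (by omega : 1 ≤ Nat.log 2 n)
  obtain ⟨m, hm, hmn, z, hz⟩ := exists_problem_not_level (n := n) (k := k) hC h
    (hk ▸ Nat.pow_log_le_self 2 (by omega))
  obtain ⟨A, hAC, hcard, hA⟩ := exists_identifies_of_not_level hz
  refine (lt_minDepth_of_identifies (by omega) hAC hA ?_ κ).trans
    (minDepth_le_shannon _ hm hmn z)
  rw [hk, hcard]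
  set q := Nat.log 2 (k + 1) + 1
  calc 2 * (k + 1) ^ ((k + 1 - 2) / q) ≤ 2 * (2 ^ q) ^ ((k + 1 - 2) / q) :=
        Nat.mul_le_mul_left _ (Nat.pow_le_pow_left
          (Nat.lt_pow_succ_log_self one_lt_two _).le _)
    _ = 2 ^ (q * ((k + 1 - 2) / q) + 1) := by rw [← pow_mul, pow_succ']
    _ ≤ 2 ^ k := Nat.pow_le_pow_right two_pos (by
        have := Nat.mul_div_le (k + 1 - 2) q
        omega)

/-! ### Asymptotics -/

theorem natLog_mul_log_two_le (n : ℕ) : (Nat.log 2 n : ℝ) * Real.log 2 ≤ Real.log n := by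
  have h := Real.natLog_le_logb n 2
  rwa [Real.logb, Nat.cast_ofNat, le_div_iff₀ (Real.log_pos one_lt_two)] at h

theorem log_le_natLog_add_one_mul (hn : 1 ≤ n) :
    Real.log n ≤ ((Nat.log 2 n : ℝ) + 1) * Real.log 2 := by
  have h : (n : ℝ) ≤ 2 ^ (Nat.log 2 n + 1) := by
    exact_mod_cast (Nat.lt_pow_succ_log_self one_lt_two n).le
  calc Real.log n ≤ Real.log (2 ^ (Nat.log 2 n + 1)) :=
        Real.log_le_log (by exact_mod_cast hn) h
    _ = _ := by rw [Real.log_pow]; push_cast; ring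

theorem le_toNat_of_le {a : ℕ∞} (ha : a ≠ ⊤) {m : ℕ} (h : (m : ℕ∞) ≤ a) : m ≤ a.toNat := by
  simpa using ENat.toNat_le_toNat h ha

theorem shannon_isBigO_log {C : Set (Set U)} (hC : C.Nonempty) (hD : ClassD C) (hI : ClassI C)
    (κ : TreeKind) :
    (fun n : ℕ => ((shannon κ C n).toNat : ℝ)) =O[atTop] fun n : ℕ => Real.log n := by
  obtain ⟨a, ha⟩ := exists_shannon_le_clog hC hD hI κ
  refine IsBigO.of_bound (4 * a) ?_
  filter_upwards [eventually_ge_atTop 2] with n hn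
  have h1 : (shannon κ C n).toNat ≤ a * (Nat.log 2 n + 1) :=
    (ENat.toNat_le_of_le_natCast (ha n)).trans (Nat.mul_le_mul_left a
      (Nat.clog_le_of_le_pow (Nat.lt_pow_succ_log_self one_lt_two n)))
  have h2 : (1 : ℝ) ≤ Nat.log 2 n := by exact_mod_cast Nat.log_pos one_lt_two hn
  have h3 := natLog_mul_log_two_le n
  have h4 : (1 : ℝ) / 2 ≤ Real.log 2 := by linarith [Real.log_two_gt_d9]
  have h5 : ((shannon κ C n).toNat : ℝ) ≤ a * (Nat.log 2 n + 1) := by exact_mod_cast h1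
  have h6 : (Nat.log 2 n : ℝ) + 1 ≤ 4 * Real.log n := by nlinarith
  rw [Real.norm_of_nonneg (Nat.cast_nonneg _), Real.norm_of_nonneg (Real.log_natCast_nonneg n)]
  calc ((shannon κ C n).toNat : ℝ) ≤ a * (Nat.log 2 n + 1) := h5
    _ ≤ a * (4 * Real.log n) := mul_le_mul_of_nonneg_left h6 (Nat.cast_nonneg a)
    _ = 4 * a * Real.log n := by ring

theorem log_isBigO_shannon_properEq {C : Set (Set U)} (hC : C.Infinite) (h : ¬ ClassC C) :
    (fun n : ℕ => Real.log n) =O[atTop] fun n : ℕ => ((shannon .properEq C n).toNat : ℝ) := by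
  refine IsBigO.of_bound 2 ?_
  filter_upwards [eventually_ge_atTop 2] with n hn
  have h1 : (Nat.log 2 n : ℝ) ≤ (shannon .properEq C n).toNat := by
    exact_mod_cast le_toNat_of_le (shannon_ne_top hC.nonempty _ n) (natLog_le_shannon_properEq hC h hn)
  have h2 : (1 : ℝ) ≤ Nat.log 2 n := by exact_mod_cast Nat.log_pos one_lt_two hn
  have h3 := log_le_natLog_add_one_mul (n := n) (by omega)
  have h4 : Real.log 2 ≤ 1 := by linarith [Real.log_two_lt_d9]
  rw [Real.norm_of_nonneg (Nat.cast_nonneg _), Real.norm_of_nonneg (Real.log_natCast_nonneg n)]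
  nlinarith

theorem log_div_log_log_isBigO_shannon {C : Set (Set U)} (hC : C.Infinite) (h : ¬ ClassC C)
    (κ : TreeKind) :
    (fun n : ℕ => Real.log n / Real.log (Real.log n)) =O[atTop]
      fun n : ℕ => ((shannon κ C n).toNat : ℝ) := by
  refine IsBigO.of_bound 16 ?_
  filter_upwards [eventually_ge_atTop 16] with n hn
  set s := (shannon κ C n).toNat
  set K := Nat.log 2 n
  set m := Nat.log 2 K
  have hK : 4 ≤ K := (Nat.le_log_iff_pow_le one_lt_two (by omega)).mpr (by omega)
  have h1 : (K - 2) / (m + 1) + 1 ≤ s := le_toNat_of_le (shannon_ne_top hC.nonempty κ n)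
    (natLog_div_le_shannon hC h (by omega) κ)
  -- Multiply out the floor division; the additive constant is absorbed since `s ≥ 1`.
  have h2 : K ≤ 2 * ((m + 1) * s) := by
    have h3 : K - 2 < (m + 1) * s :=
      mul_comm s (m + 1) ▸ (Nat.div_lt_iff_lt_mul (Nat.succ_pos m)).mp h1
    omega
  have h2' : (K : ℝ) ≤ 2 * (((m : ℝ) + 1) * s) := by exact_mod_cast h2
  have hK' : (4 : ℝ) ≤ K := by exact_mod_cast hK
  have hlog2 : 0 < Real.log 2 := Real.log_pos one_lt_two
  have hlog2_ge : (1 : ℝ) / 2 ≤ Real.log 2 := by linarith [Real.log_two_gt_d9]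
  have h3 : Real.log n ≤ (K + 1) * Real.log 2 := log_le_natLog_add_one_mul (by omega)
  have h4 : (K : ℝ) * Real.log 2 ≤ Real.log n := natLog_mul_log_two_le n
  have h5 : (m : ℝ) * Real.log 2 ≤ Real.log K := natLog_mul_log_two_le K
  have hlogn : 2 ≤ Real.log n := by nlinarith
  have h6 : Real.log 2 ≤ Real.log (Real.log n) := Real.log_le_log two_pos hlogn
  have h7 : Real.log K ≤ Real.log 2 + Real.log (Real.log n) := by
    rw [← Real.log_mul two_ne_zero (by linarith)]
    exact Real.log_le_log (by linarith) (by nlinarith)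
  have hs : (0 : ℝ) ≤ s := Nat.cast_nonneg s
  have h8 : ((m : ℝ) + 1) * Real.log 2 ≤ 3 * Real.log (Real.log n) := by linarith
  have hpos : 0 < Real.log (Real.log n) := hlog2.trans_le h6
  rw [Real.norm_of_nonneg (by positivity), Real.norm_of_nonneg hs, div_le_iff₀ hpos]
  calc Real.log n ≤ 2 * (K * Real.log 2) := by nlinarith
    _ ≤ 2 * (2 * (((m : ℝ) + 1) * s) * Real.log 2) := by gcongr
    _ = 4 * s * (((m : ℝ) + 1) * Real.log 2) := by ring
    _ ≤ 4 * s * (3 * Real.log (Real.log n)) := by gcongr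
    _ ≤ 16 * s * Real.log (Real.log n) := by nlinarith [mul_nonneg hs hpos.le]

theorem shannon_isBigO_one {C : Set (Set U)} (hC : C.Nonempty) (h : ClassC C) (hI : ClassI C)
    (κ : TreeKind) :
    (fun n : ℕ => ((shannon κ C n).toNat : ℝ)) =O[atTop] fun _ : ℕ => (1 : ℝ) := by
  obtain ⟨d, hd⟩ := exists_shannon_le_of_classC_classI hC h hI κ
  refine IsBigO.of_bound d (Eventually.of_forall fun n => ?_)
  have : ((shannon κ C n).toNat : ℝ) ≤ d := by
    exact_mod_cast ENat.toNat_le_of_le_natCast (hd n)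
  simpa using this

end ExactLearning

theorem theorem3 {U : Type*} [Infinite U] (C : Set (Set U)) (hC : C.Infinite) :
    -- the minima and maxima in the definitions exist
    (∀ (κ : TreeKind) (n : ℕ), 1 ≤ n → shannon κ C n ≠ ⊤) ∧
    -- (a)
    (ClassC C ∧ ClassI C →
      (fun n : ℕ => ((shannon .properEq C n).toNat : ℝ)) =O[atTop] (fun _ : ℕ => (1 : ℝ)) ∧
      (fun n : ℕ => ((shannon .memAndProperEq C n).toNat : ℝ)) =O[atTop]
        (fun _ : ℕ => (1 : ℝ))) ∧
    -- (b)
    ((ClassD C ∧ ¬ ClassC C) ∧ ClassI C →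
      (fun n : ℕ => ((shannon .properEq C n).toNat : ℝ)) =Θ[atTop]
        (fun n : ℕ => Real.log n) ∧
      (fun n : ℕ => Real.log n / Real.log (Real.log n)) =O[atTop]
        (fun n : ℕ => ((shannon .memAndProperEq C n).toNat : ℝ)) ∧
      (fun n : ℕ => ((shannon .memAndProperEq C n).toNat : ℝ)) =O[atTop]
        (fun n : ℕ => Real.log n)) ∧
    -- (c)
    (ClassD C ∧ ¬ ClassI C → ∀ κ : TreeKind,
      {n : ℕ | 1 ≤ n ∧ ((n - 1 : ℕ) : ℕ∞) ≤ shannon κ C n}.Infinite ∧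
      ∀ n : ℕ, 1 ≤ n → shannon κ C n ≤ n) ∧
    -- (d)
    (¬ ClassD C → ∀ n : ℕ, 1 ≤ n →
      shannon .properEq C n = n ∧ shannon .memAndProperEq C n = n) := by
  have hne := hC.nonempty
  refine ⟨fun κ n _ => shannon_ne_top hne κ n, ?_, ?_, ?_, ?_⟩
  · rintro ⟨hk, hI⟩
    exact ⟨shannon_isBigO_one hne hk hI _, shannon_isBigO_one hne hk hI _⟩
  · rintro ⟨⟨hD, hk⟩, hI⟩
    exact ⟨⟨shannon_isBigO_log hne hD hI _, log_isBigO_shannon_properEq hC hk⟩,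
      log_div_log_log_isBigO_shannon hC hk _, shannon_isBigO_log hne hD hI _⟩
  · rintro ⟨-, hI⟩ κ
    refine ⟨Set.infinite_of_not_bddAbove ?_, fun n _ => shannon_le_dim hne κ n⟩
    rintro ⟨r, hr⟩
    obtain ⟨n, hnr, hn⟩ := exists_pred_dim_le_shannon_of_not_classI hI r κ
    exact absurd (hr hn) (by omega)
  · exact fun hD n hn => ⟨shannon_eq_dim_of_not_classD hne hD hn _,
      shannon_eq_dim_of_not_classD hne hD hn _⟩
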